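/- Let $W$ be a discrete memoryless channel with finite input alphabet $\mathcal X$, finite output alphabet $\mathcal Y$ and strictly positive transition probabilities $W_x(y)=W(y|x)$; let $\lambda=\min_{x,y}W(y|x)>0$. All logarithms are natural. For a probability distribution $P$ on $\mathcal X$ let $Q_P(y)=\sum_x P(x)W(y|x)$ be the induced output distribution and $I(P,W)=\sum_{x,y}P(x)W(y|x)\ln\frac{W(y|x)}{Q_P(y)}$ the mutual information; let $C=\max_P I(P,W)$ be the capacity, and let $D(\cdot\|\cdot)$ denote Kullback-Leibler divergence. For $R\le C$ let $$J(R)=\max\bigl\{\alpha D(Q_{P_1}\|W_{x_1})+(1-\alpha)D(Q_{P_2}\|W_{x_2})\;:\;0\le\alpha\le1,\ x_1,x_2\in\mathcal X,\ P_1,P_2\text{ distributions on }\mathcal X,\ \alpha I(P_1,W)+(1-\alpha)I(P_2,W)\ge R\bigr\}.$$ A length-$n$ block code with feedback and erasures with message set $\mathcal M$ consists of encoding maps giving, for each time $t\in\{1,\dots,n\}$, the input letter $x_t\in\mathcal X$ as a function of the message $m\in\mathcal M$ and the previous channel outputs $y_1,\dots,y_{t-1}$, and of a decoding map $\mathcal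 Y^n\to\mathcal M\cup\{\mathbf x\}$, where $\mathbf x$ is the erasure symbol. Write $\hat M$ for the decoder output and $P(\cdot\mid m)$ for the law of the channel outputs when the message is $m$. If $\mathcal M=\mathcal M_1\times\dots\times\mathcal M_\ell$, write $\mathcal M^i=\mathcal M_1\times\dots\times\mathcal M_i$, let $m^i$ and $\hat M^i$ denote the first $i$ sub-messages, and put $$P_{\mathbf e|m}(i)=P\bigl(\hat M\ne\mathbf x,\ \hat M^i\ne m^i\mid m\bigr),\qquad P_{\mathbf x|m}=P\bigl(\hat M=\mathbf x\mid m\bigr).$$ **Claim.** Let $n\ge1$ and $0\le\ell\le \frac{n}{\ln(1+n)}$ be integers, and let $(R_1,\dots,R_\ell)$ and $(\eta_1,\dots,\eta_\ell)$ be real vectors with $\eta_i\ge0$ and $R_i\le C\eta_i$ for all $i$, and $\sum_{i=1}^{\ell}\eta_i\le1$. Set $\eta_{\ell+1}=1-\sum_{i=1}^{\ell}\eta_i$, $R_{\ell+1}=0$, and $$\varepsilon=\varepsilon_{n,\ell}=\frac{10\,|\mathcal X|\,|\mathcal Y|\,\ln(e/\lambda)\,\sqrt{\ln(1+n)}}{\sqrt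 n}\,\sqrt{1+\ell},$$ and read $\eta_jJ(R_j/\eta_j)$ as $0$ when $\eta_j=0$. Then there exists a length-$n$ block code with feedback and erasures, with finite message set $\mathcal M=\mathcal M_1\times\dots\times\mathcal M_\ell$, such that \begin{align*} |\mathcal M_i|&\ge e^{n(R_i-\varepsilon)} && \text{for all } i\in\{1,\dots,\ell\},\\ |\mathcal M^i|&\ge e^{n\left(-\varepsilon+\sum_{j=1}^{i}R_j\right)} && \text{for all } i\in\{1,\dots,\ell\},\\ P_{\mathbf e|m}(i)&\le \varepsilon\, e^{-n\left(-\varepsilon+\sum_{j=i+1}^{\ell+1}\eta_jJ(R_j/\eta_j)\right)} && \text{for all } m\in\mathcal M,\ i\in\{1,\dots,\ell\},\\ P_{\mathbf x|m}&\le\varepsilon && \text{for all } m\in\mathcal M. \end{align*} -/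

import Mathlib

namespace BitwiseUEP

open Real

/-- A discrete memoryless channel with finite input alphabet `X`, finite output alphabet `Y` and
strictly positive transition probabilities `W x y`. -/
structure Channel (X Y : Type*) [Fintype Y] where
  W : X → Y → ℝ
  pos : ∀ x y, 0 < W x y
  sum_eq_one : ∀ x, ∑ y, W x y = 1

/-- The Kullback-Leibler divergence `∑ p ln (p / q)` (in nats) on a finite alphabet.
It is only used with a strictly positive `q`; the convention `0 ln 0 = 0` holds automatically. -/
noncomputable def klDivergence {Y : Type*} [Fintype Y] (p q : Y → ℝ) : ℝ :=
  ∑ y, p y * log (p y / q y)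

namespace Channel

variable {X Y : Type*} [Fintype X] [Fintype Y]

/-- The output distribution induced by the input distribution `P`. -/
noncomputable def output (Ch : Channel X Y) (P : X → ℝ) (y : Y) : ℝ :=
  ∑ x, P x * Ch.W x y

/-- The mutual information `I(P, W)` (in nats). -/
noncomputable def mutualInfo (Ch : Channel X Y) (P : X → ℝ) : ℝ :=
  ∑ x, ∑ y, P x * Ch.W x y * log (Ch.W x y / Ch.output P y)

/-- The channel capacity: the maximum of `I(P, W)` over all input distributions `P`. -/
noncomputable def capacity (Ch : Channel X Y) : ℝ :=
  sSup (Ch.mutualInfo '' stdSimplex ℝ X)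

/-- The smallest transition probability. -/
noncomputable def minProb (Ch : Channel X Y) : ℝ :=
  ⨅ p : X × Y, Ch.W p.1 p.2

/-- The function `J(R)`: the maximum of `α D(Q₁ ‖ W_{x₁}) + (1 - α) D(Q₂ ‖ W_{x₂})`, where `Qᵢ` is
the output distribution of `Pᵢ`, subject to `α I(P₁, W) + (1 - α) I(P₂, W) ≥ R`. The constraint
set is nonempty exactly when `R` is at most the capacity. -/
noncomputable def J (Ch : Channel X Y) (R : ℝ) : ℝ :=
  sSup {v : ℝ | ∃ (α : ℝ) (x₁ x₂ : X) (P₁ P₂ : X → ℝ),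
    0 ≤ α ∧ α ≤ 1 ∧ P₁ ∈ stdSimplex ℝ X ∧ P₂ ∈ stdSimplex ℝ X ∧
    R ≤ α * Ch.mutualInfo P₁ + (1 - α) * Ch.mutualInfo P₂ ∧
    v = α * klDivergence (Ch.output P₁) (Ch.W x₁)
      + (1 - α) * klDivergence (Ch.output P₂) (Ch.W x₂)}

/-- The error term `ε_{n,ℓ} = 10 |X| |Y| ln(e / λ) √(ln (1 + n)) / √n · √(1 + ℓ)`. -/
noncomputable def eps (Ch : Channel X Y) (n ℓ : ℕ) : ℝ :=
  10 * (Fintype.card X : ℝ) * (Fintype.card Y : ℝ) * log (exp 1 / Ch.minProb)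
    * √(log (1 + n)) / √n * √(1 + ℓ)

end Channel

/-- A block code of length `n` with noiseless feedback and erasures. The input letter at time `t`
(times are numbered from `0` to `n - 1`) depends on the message and on the channel outputs before
time `t`; the decoder sees all `n` outputs and returns a message or an erasure (`none`). -/
structure FeedbackCode (X Y Msg : Type*) (n : ℕ) where
  enc : Msg → (t : Fin n) → (Fin (t : ℕ) → Y) → X
  dec : (Fin n → Y) → Option Msg

namespace FeedbackCode

variable {X Y : Type*} [Fintype Y] {n : ℕ}

/-- The conditional probability of the output sequence `y` given the message `m`. -/
noncomputable def pathProb {Msg : Type*} (code : FeedbackCode X Y Msg n) (Ch : Channel X Y)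
    (m : Msg) (y : Fin n → Y) : ℝ :=
  ∏ t : Fin n, Ch.W (code.enc m t (fun s => y (Fin.castLE t.isLt.le s))) (y t)

/-- The conditional probability, given the message `m`, that the output sequence lies in `A`. -/
noncomputable def condProb {Msg : Type*} (code : FeedbackCode X Y Msg n) (Ch : Channel X Y)
    (m : Msg) (A : Set (Fin n → Y)) : ℝ :=
  ∑ y, A.indicator (code.pathProb Ch m) y

/-- The conditional erasure probability given the message `m`. -/
noncomputable def erasureProb {Msg : Type*} (code : FeedbackCode X Y Msg n) (Ch : Channel X Y)
    (m : Msg) : ℝ :=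
  code.condProb Ch m {y | code.dec y = none}

/-- For messages made of `ℓ` sub-messages: the conditional probability, given the message `m`, that
there is no erasure and at least one of the sub-messages up to and including the one with index `i`
(indices start at `0`) is decoded incorrectly. -/
noncomputable def prefixErrorProb {ℓ : ℕ} {Sub : Fin ℓ → Type*}
    (code : FeedbackCode X Y (∀ j, Sub j) n) (Ch : Channel X Y) (m : ∀ j, Sub j) (i : Fin ℓ) : ℝ :=
  code.condProb Ch m {y | ∃ m', code.dec y = some m' ∧ ∃ j ≤ i, m' j ≠ m j}

end FeedbackCode

end BitwiseUEP

-- Split the n channel uses into ℓ + 1 consecutive phases of lengths about nη_j. Phase j ≤ ℓ carries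
-- sub-message j at rate about R_j/η_j; the last phase carries no information and only confirms or
-- rejects. Through feedback the encoder knows the decisions on the finished phases. Once one of
-- them is not the sent sub-message, it transmits a fixed reject word in every later phase, and the
-- decoder erases if any phase is rejected.
--
-- An undetected error among the first i sub-messages thus requires a first failing phase a ≤ i and
-- then acceptance of the reject word in every phase after i. Given the failure, the later phases no
-- longer depend on the history, so these probabilities multiply (`sum_first_failure_le`,
-- `prefixErrorProb_concatCode_le`). An erasure requires some failure, so it costs at most the sum
-- of the block error probabilities.
--
-- The block codes come from Feinstein's greedy construction (`exists_code_rejecting`). A good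
-- output must have information density near I(P, W), which gives the code size, and a
-- log-likelihood ratio of Q_P against the reject word near the divergence, which by change of
-- measure makes acceptance of the reject word exponentially unlikely. Time sharing between two
-- pairs (P, x) reaches J. Chernoff bounds with tail probability 1/(1 + n) control both typicality
-- conditions, and balancing their two costs over all phases gives the order √((1 + ℓ) ln(1 + n) /
-- n) of ε.

namespace BitwiseUEP

open Real

-- One-letter bounds on divergence, mutual information, capacity and J.

/-- Gibbs' inequality. -/
theorem klDivergence_nonneg {Y : Type*} [Fintype Y] {p q : Y → ℝ} (hp : ∀ y, 0 < p y)
    (hq : ∀ y, 0 < q y) (hp1 : ∑ y, p y = 1) (hq1 : ∑ y, q y = 1) : 0 ≤ klDivergence p q := by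
  have h : ∑ y, (p y - q y) ≤ klDivergence p q := by
    refine Finset.sum_le_sum fun y _ => ?_
    have h1 := one_sub_inv_le_log_of_pos (div_pos (hp y) (hq y))
    have h2 := mul_le_mul_of_nonneg_left h1 (hp y).le
    have h3 : p y * (1 - (p y / q y)⁻¹) = p y - q y := by
      have := (hp y).ne'
      have := (hq y).ne'
      field_simp
    linarith
  rwa [Finset.sum_sub_distrib, hp1, hq1, sub_self] at h

namespace Channel

variable {X Y : Type*} [Fintype X] [Fintype Y]

theorem minProb_le (Ch : Channel X Y) (x : X) (y : Y) : Ch.minProb ≤ Ch.W x y :=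
  ciInf_le (Set.finite_range (fun p : X × Y => Ch.W p.1 p.2)).bddBelow (x, y)

omit [Fintype X] in
theorem W_le_one (Ch : Channel X Y) (x : X) (y : Y) : Ch.W x y ≤ 1 := by
  rw [← Ch.sum_eq_one x]
  exact Finset.single_le_sum (fun z _ => (Ch.pos x z).le) (Finset.mem_univ y)

omit [Fintype X] in
theorem nonempty_output (Ch : Channel X Y) [Nonempty X] : Nonempty Y := by
  by_contra h
  rw [not_nonempty_iff] at h
  have := Ch.sum_eq_one (Classical.arbitrary X)
  simp at this

theorem minProb_pos (Ch : Channel X Y) [Nonempty X] : 0 < Ch.minProb := by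
  have := Ch.nonempty_output
  obtain ⟨p, hp⟩ := exists_eq_ciInf_of_finite (f := fun p : X × Y => Ch.W p.1 p.2)
  rw [minProb, ← hp]
  exact Ch.pos _ _

/-- The largest value `-ln λ` that a log-likelihood ratio of the channel can take. -/
noncomputable def maxLLR (Ch : Channel X Y) : ℝ := -log Ch.minProb

theorem maxLLR_nonneg (Ch : Channel X Y) [Nonempty X] : 0 ≤ Ch.maxLLR := by
  have := Ch.nonempty_output
  have h := (Ch.minProb_le (Classical.arbitrary X) (Classical.arbitrary Y)).trans (Ch.W_le_one _ _)
  have := log_nonpos Ch.minProb_pos.le h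
  rw [maxLLR]
  linarith

/-- Both logarithms lie in [ln λ, 0]. This makes every log-likelihood ratio below a bounded
variable, as the Chernoff bounds require. -/
theorem abs_log_div_le (Ch : Channel X Y) [Nonempty X] {a b : ℝ} (ha : Ch.minProb ≤ a)
    (ha1 : a ≤ 1) (hb : Ch.minProb ≤ b) (hb1 : b ≤ 1) : |log (a / b)| ≤ Ch.maxLLR := by
  have h0 := Ch.minProb_pos
  have ha0 := h0.trans_le ha
  have hb0 := h0.trans_le hb
  rw [log_div ha0.ne' hb0.ne', maxLLR, abs_le]
  have := log_le_log h0 ha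
  have := log_le_log h0 hb
  have := log_nonpos ha0.le ha1
  have := log_nonpos hb0.le hb1
  constructor <;> linarith

theorem sum_output (Ch : Channel X Y) {P : X → ℝ} (hP : P ∈ stdSimplex ℝ X) :
    ∑ y, Ch.output P y = 1 := by
  simp only [output]
  rw [Finset.sum_comm]
  simp only [← Finset.mul_sum, Ch.sum_eq_one, mul_one, hP.2]

theorem minProb_le_output (Ch : Channel X Y) {P : X → ℝ} (hP : P ∈ stdSimplex ℝ X) (y : Y) :
    Ch.minProb ≤ Ch.output P y := by
  calc Ch.minProb = ∑ x, P x * Ch.minProb := by rw [← Finset.sum_mul, hP.2, one_mul]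
    _ ≤ _ := Finset.sum_le_sum fun x _ => mul_le_mul_of_nonneg_left (Ch.minProb_le x y) (hP.1 x)

theorem output_le_one (Ch : Channel X Y) {P : X → ℝ} (hP : P ∈ stdSimplex ℝ X) (y : Y) :
    Ch.output P y ≤ 1 := by
  calc Ch.output P y ≤ ∑ x, P x * 1 :=
        Finset.sum_le_sum fun x _ => mul_le_mul_of_nonneg_left (Ch.W_le_one x y) (hP.1 x)
    _ = 1 := by rw [← Finset.sum_mul, hP.2, one_mul]

theorem output_pos (Ch : Channel X Y) [Nonempty X] {P : X → ℝ} (hP : P ∈ stdSimplex ℝ X) (y : Y) :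
    0 < Ch.output P y :=
  Ch.minProb_pos.trans_le (Ch.minProb_le_output hP y)

theorem klDivergence_output_nonneg (Ch : Channel X Y) [Nonempty X] {P : X → ℝ}
    (hP : P ∈ stdSimplex ℝ X) (x : X) : 0 ≤ klDivergence (Ch.output P) (Ch.W x) :=
  klDivergence_nonneg (Ch.output_pos hP) (Ch.pos x) (Ch.sum_output hP) (Ch.sum_eq_one x)

theorem klDivergence_output_le (Ch : Channel X Y) [Nonempty X] {P : X → ℝ}
    (hP : P ∈ stdSimplex ℝ X) (x : X) : klDivergence (Ch.output P) (Ch.W x) ≤ Ch.maxLLR := by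
  calc klDivergence (Ch.output P) (Ch.W x) ≤ ∑ y, Ch.output P y * Ch.maxLLR :=
        Finset.sum_le_sum fun y _ => mul_le_mul_of_nonneg_left
          ((le_abs_self _).trans (Ch.abs_log_div_le (Ch.minProb_le_output hP y)
            (Ch.output_le_one hP y) (Ch.minProb_le x y) (Ch.W_le_one x y))) (Ch.output_pos hP y).le
    _ = Ch.maxLLR := by rw [← Finset.sum_mul, Ch.sum_output hP, one_mul]

theorem mutualInfo_eq (Ch : Channel X Y) (P : X → ℝ) :
    Ch.mutualInfo P = ∑ x, P x * klDivergence (Ch.W x) (Ch.output P) := by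
  simp only [mutualInfo, klDivergence, Finset.mul_sum, mul_assoc]

theorem mutualInfo_nonneg (Ch : Channel X Y) [Nonempty X] {P : X → ℝ}
    (hP : P ∈ stdSimplex ℝ X) : 0 ≤ Ch.mutualInfo P := by
  rw [mutualInfo_eq]
  exact Finset.sum_nonneg fun x _ => mul_nonneg (hP.1 x) <|
    klDivergence_nonneg (Ch.pos x) (Ch.output_pos hP) (Ch.sum_eq_one x) (Ch.sum_output hP)

theorem mutualInfo_le (Ch : Channel X Y) [Nonempty X] {P : X → ℝ}
    (hP : P ∈ stdSimplex ℝ X) : Ch.mutualInfo P ≤ Ch.maxLLR := by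
  calc Ch.mutualInfo P ≤ ∑ x, ∑ y, P x * Ch.W x y * Ch.maxLLR :=
        Finset.sum_le_sum fun x _ => Finset.sum_le_sum fun y _ => mul_le_mul_of_nonneg_left
          ((le_abs_self _).trans (Ch.abs_log_div_le (Ch.minProb_le x y) (Ch.W_le_one x y)
            (Ch.minProb_le_output hP y) (Ch.output_le_one hP y)))
          (mul_nonneg (hP.1 x) (Ch.pos x y).le)
    _ = Ch.maxLLR := by
        simp only [← Finset.sum_mul, ← Finset.mul_sum, Ch.sum_eq_one, mul_one, hP.2, one_mul]

theorem continuousOn_mutualInfo (Ch : Channel X Y) [Nonempty X] :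
    ContinuousOn Ch.mutualInfo (stdSimplex ℝ X) := by
  refine continuousOn_finsetSum _ fun x _ => continuousOn_finsetSum _ fun y _ => ?_
  have hout : Continuous fun P : X → ℝ => Ch.output P y := by
    unfold output
    fun_prop
  refine ContinuousOn.mul (by fun_prop) (ContinuousOn.log ?_ fun P hP => ?_)
  · exact continuousOn_const.div hout.continuousOn fun P hP => (Ch.output_pos hP y).ne'
  · exact (div_pos (Ch.pos x y) (Ch.output_pos hP y)).ne'

theorem nonempty_stdSimplex [Nonempty X] : (stdSimplex ℝ X).Nonempty := by
  classical
  exact ⟨_, single_mem_stdSimplex ℝ (Classical.arbitrary X)⟩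

/-- The capacity is attained. -/
theorem exists_mutualInfo_eq_capacity (Ch : Channel X Y) [Nonempty X] :
    ∃ P ∈ stdSimplex ℝ X, Ch.mutualInfo P = Ch.capacity := by
  obtain ⟨P, hP, hmax⟩ := (isCompact_stdSimplex ℝ X).exists_sSup_image_eq nonempty_stdSimplex
    Ch.continuousOn_mutualInfo
  exact ⟨P, hP, hmax.symm⟩

theorem capacity_nonneg (Ch : Channel X Y) [Nonempty X] : 0 ≤ Ch.capacity := by
  obtain ⟨P, hP, h⟩ := Ch.exists_mutualInfo_eq_capacity
  exact h ▸ Ch.mutualInfo_nonneg hP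

theorem capacity_le (Ch : Channel X Y) [Nonempty X] : Ch.capacity ≤ Ch.maxLLR := by
  obtain ⟨P, hP, h⟩ := Ch.exists_mutualInfo_eq_capacity
  exact h ▸ Ch.mutualInfo_le hP

/-- Feasible points of the maximisation problem that defines `J` come arbitrarily close to its
supremum. -/
theorem exists_lt_of_lt_J (Ch : Channel X Y) [Nonempty X] {R κ : ℝ} (hR : R ≤ Ch.capacity)
    (hκ : 0 < κ) :
    ∃ (α : ℝ) (x₁ x₂ : X) (P₁ P₂ : X → ℝ),
      0 ≤ α ∧ α ≤ 1 ∧ P₁ ∈ stdSimplex ℝ X ∧ P₂ ∈ stdSimplex ℝ X ∧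
      R ≤ α * Ch.mutualInfo P₁ + (1 - α) * Ch.mutualInfo P₂ ∧
      Ch.J R - κ < α * klDivergence (Ch.output P₁) (Ch.W x₁)
        + (1 - α) * klDivergence (Ch.output P₂) (Ch.W x₂) := by
  obtain ⟨P, hP, h⟩ := Ch.exists_mutualInfo_eq_capacity
  obtain ⟨x⟩ := ‹Nonempty X›
  -- A capacity-achieving P with α = 1 is feasible, so the supremum can be approached; its
  -- attainment is not needed.
  obtain ⟨v, ⟨α, x₁, x₂, P₁, P₂, h0, h1, hP₁, hP₂, hle, rfl⟩, hv⟩ :=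
    exists_lt_of_lt_csSup (b := Ch.J R - κ) (s := {v : ℝ | ∃ (α : ℝ) (x₁ x₂ : X) (P₁ P₂ : X → ℝ),
      0 ≤ α ∧ α ≤ 1 ∧ P₁ ∈ stdSimplex ℝ X ∧ P₂ ∈ stdSimplex ℝ X ∧
      R ≤ α * Ch.mutualInfo P₁ + (1 - α) * Ch.mutualInfo P₂ ∧
      v = α * klDivergence (Ch.output P₁) (Ch.W x₁)
        + (1 - α) * klDivergence (Ch.output P₂) (Ch.W x₂)})
      ⟨_, 1, x, x, P, P, zero_le_one, le_rfl, hP, hP, by rw [h]; linarith, rfl⟩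
      (sub_lt_self _ hκ)
  exact ⟨α, x₁, x₂, P₁, P₂, h0, h1, hP₁, hP₂, hle, hv⟩

end Channel

open scoped Classical

-- Chernoff bounds.

section

variable {Z : Type*} [Fintype Z]

/-- A one-letter moment generating function bound. -/
theorem sum_mul_exp_le {p f : Z → ℝ} {L s : ℝ} (hp : ∀ z, 0 ≤ p z) (hp1 : ∑ z, p z = 1)
    (hf : ∀ z, |f z| ≤ L) (hs : 0 ≤ s) (hsL : 2 * s * L ≤ 1) :
    ∑ z, p z * exp (s * (∑ w, p w * f w - f z)) ≤ exp (s ^ 2 * L ^ 2) := by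
  set E := ∑ w, p w * f w with hE
  have hEL : |E| ≤ L := by
    calc |E| ≤ ∑ w, |p w * f w| := Finset.abs_sum_le_sum_abs _ _
      _ ≤ ∑ w, p w * L := Finset.sum_le_sum fun w _ => by
          rw [abs_mul, abs_of_nonneg (hp w)]
          exact mul_le_mul_of_nonneg_left (hf w) (hp w)
      _ = L := by rw [← Finset.sum_mul, hp1, one_mul]
  -- Use exp x ≤ 1 + x + x² for |x| ≤ 1, expand (E - f)² and replace f² by L². The result is affine
  -- in f, so averaging needs only the mean E.
  have hterm : ∀ z, p z * exp (s * (E - f z)) ≤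
      p z * (1 + s * E + s ^ 2 * E ^ 2 + s ^ 2 * L ^ 2)
        - (s + 2 * s ^ 2 * E) * (p z * f z) := by
    intro z
    have h1 : |s * (E - f z)| ≤ 1 := by
      rw [abs_mul, abs_of_nonneg hs]
      have h2 : |E - f z| ≤ 2 * L := (abs_sub _ _).trans (by linarith [hf z])
      nlinarith
    have h3 := (abs_le.1 (abs_exp_sub_one_sub_id_le h1)).2
    have h4 : f z ^ 2 ≤ L ^ 2 := sq_le_sq' (by linarith [(abs_le.1 (hf z)).1]) (abs_le.1 (hf z)).2
    have h5 : exp (s * (E - f z)) ≤ (1 + s * E + s ^ 2 * E ^ 2 + s ^ 2 * L ^ 2)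
        - (s + 2 * s ^ 2 * E) * f z := by nlinarith [sq_nonneg s]
    calc _ ≤ p z * ((1 + s * E + s ^ 2 * E ^ 2 + s ^ 2 * L ^ 2)
        - (s + 2 * s ^ 2 * E) * f z) := mul_le_mul_of_nonneg_left h5 (hp z)
      _ = _ := by ring
  calc ∑ z, p z * exp (s * (E - f z)) ≤ _ := Finset.sum_le_sum fun z _ => hterm z
    _ = (1 + s * E + s ^ 2 * E ^ 2 + s ^ 2 * L ^ 2) - (s + 2 * s ^ 2 * E) * E := by
        rw [Finset.sum_sub_distrib, ← Finset.sum_mul, hp1, ← Finset.mul_sum, one_mul, ← hE]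
    _ ≤ s ^ 2 * L ^ 2 + 1 := by nlinarith [sq_nonneg (s * E)]
    _ ≤ _ := add_one_le_exp _

/-- A Chernoff bound for the lower tail of a sum of independent bounded variables. -/
theorem sum_prod_lower_tail_le {N : ℕ} {p f : Fin N → Z → ℝ} {L s τ : ℝ}
    (hp : ∀ t z, 0 ≤ p t z) (hp1 : ∀ t, ∑ z, p t z = 1) (hf : ∀ t z, |f t z| ≤ L) (hs : 0 ≤ s)
    (hsL : 2 * s * L ≤ 1) :
    ∑ z : Fin N → Z, (if ∑ t, f t (z t) < ∑ t, ∑ w, p t w * f t w - τ then ∏ t, p t (z t) else 0)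
      ≤ exp (-s * τ + s ^ 2 * L ^ 2 * N) := by
  calc _ ≤ ∑ z : Fin N → Z, exp (-s * τ) *
        ∏ t, (p t (z t) * exp (s * (∑ w, p t w * f t w - f t (z t)))) := by
        refine Finset.sum_le_sum fun z _ => ?_
        have hpos : 0 ≤ ∏ t, p t (z t) := Finset.prod_nonneg fun t _ => hp t _
        rw [Finset.prod_mul_distrib, ← exp_sum, mul_left_comm, ← exp_add]
        split_ifs with h
        · refine le_mul_of_one_le_right hpos (one_le_exp ?_)
          rw [← Finset.mul_sum, Finset.sum_sub_distrib]
          nlinarith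
        · positivity
    _ = exp (-s * τ) * ∏ t, ∑ z, p t z * exp (s * (∑ w, p t w * f t w - f t z)) := by
        rw [← Finset.mul_sum, Finset.prod_univ_sum, Fintype.piFinset_univ]
    _ ≤ exp (-s * τ) * ∏ _t : Fin N, exp (s ^ 2 * L ^ 2) := by
        refine mul_le_mul_of_nonneg_left (Finset.prod_le_prod (fun t _ => ?_) fun t _ => ?_)
          (exp_pos _).le
        · exact Finset.sum_nonneg fun z _ => mul_nonneg (hp t z) (exp_pos _).le
        · exact sum_mul_exp_le (hp t) (hp1 t) (hf t) hs hsL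
    _ = _ := by
        rw [Finset.prod_const, Finset.card_univ, Fintype.card_fin, ← exp_nat_mul, ← exp_add]
        ring_nf

end

-- Feinstein's greedy construction.

section

variable {A B : Type*} [Fintype A] [Fintype B]

/-- One step of Feinstein's greedy construction: a codeword all of whose output mass but `δ` falls
into its good set and outside the set `U` already used. -/
theorem exists_codeword {P : A → ℝ} {K : A → B → ℝ} {G : A → B → Prop} {q δ u : ℝ} {U : B → Prop}
    (hP : ∀ a, 0 ≤ P a) (hP1 : ∑ a, P a = 1) (hK : ∀ a b, 0 ≤ K a b)
    (hq : ∑ a, ∑ b, (if G a b then 0 else P a * K a b) ≤ q)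
    (hU : ∑ b, (if U b then ∑ a, P a * K a b else 0) ≤ u) (hu : u ≤ δ - q) :
    ∃ a, ∑ b, (if G a b ∧ ¬ U b then 0 else K a b) ≤ δ := by
  by_contra! hcon
  have hne : (Finset.univ : Finset A).Nonempty := by
    by_contra h
    rw [Finset.not_nonempty_iff_eq_empty] at h
    simp [h] at hP1
  -- If every input leaves more than δ uncovered, so does the P-average; but that average is at most
  -- q from bad pairs plus u from used outputs.
  have h1 : δ < ∑ a, P a * ∑ b, (if G a b ∧ ¬ U b then 0 else K a b) := by
    have hδ : ∑ a, P a * δ = δ := by rw [← Finset.sum_mul, hP1, one_mul]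
    rw [← hδ]
    have hex : ∃ a, 0 < P a := by
      by_contra! h
      have := Finset.sum_nonpos fun a (_ : a ∈ Finset.univ) => h a
      linarith
    obtain ⟨a, ha⟩ := hex
    exact Finset.sum_lt_sum (fun a _ => mul_le_mul_of_nonneg_left (hcon a).le (hP a))
      ⟨a, Finset.mem_univ a, mul_lt_mul_of_pos_left (hcon a) ha⟩
  have h2 : ∑ a, P a * ∑ b, (if G a b ∧ ¬ U b then 0 else K a b) ≤
      ∑ a, ∑ b, (if G a b then 0 else P a * K a b) +
        ∑ b, (if U b then ∑ a, P a * K a b else 0) := by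
    have h3 : ∑ b, (if U b then ∑ a, P a * K a b else 0)
        = ∑ a, ∑ b, (if U b then P a * K a b else 0) := by
      rw [Finset.sum_comm]
      refine Finset.sum_congr rfl fun b _ => ?_
      split_ifs <;> simp
    rw [h3, ← Finset.sum_add_distrib]
    refine Finset.sum_le_sum fun a _ => ?_
    rw [Finset.mul_sum, ← Finset.sum_add_distrib]
    refine Finset.sum_le_sum fun b _ => ?_
    have := mul_nonneg (hP a) (hK a b)
    by_cases hg : G a b <;> by_cases hb : U b <;> simp [hg, hb, this]
  linarith

/-- Feinstein's lemma. If the good set `G a` has output probability at most `g` for each input `a`,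
and the bad pairs have total probability at most `q`, then there is a code whose maximal error
probability is at most `δ` and whose decoding regions lie in the good sets, of any size `M` with
`(M - 1) g ≤ δ - q`. -/
theorem exists_code_of_good_sets {P : A → ℝ} {K : A → B → ℝ} {G : A → B → Prop} {q δ g : ℝ}
    (hP : ∀ a, 0 ≤ P a) (hP1 : ∑ a, P a = 1) (hK : ∀ a b, 0 ≤ K a b)
    (hq : ∑ a, ∑ b, (if G a b then 0 else P a * K a b) ≤ q)
    (hg0 : 0 ≤ g) (hg : ∀ a, ∑ b, (if G a b then ∑ a', P a' * K a' b else 0) ≤ g) (M : ℕ)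
    (hM : ((M : ℝ) - 1) * g ≤ δ - q) :
    ∃ (c : Fin M → A) (dec : B → Option (Fin M)),
      (∀ i, ∑ b, (if dec b = some i then 0 else K (c i) b) ≤ δ) ∧
      ∀ b i, dec b = some i → G (c i) b := by
  induction M with
  | zero => exact ⟨Fin.elim0, fun _ => none, fun i => i.elim0, fun b i => i.elim0⟩
  | succ M ih =>
    obtain ⟨c, dec, herr, hgood⟩ := ih (by push_cast at hM; nlinarith)
    -- The used outputs lie in the union of the M earlier good sets, each of output mass at most g.
    have hU : ∑ b, (if dec b ≠ none then ∑ a, P a * K a b else 0) ≤ M * g := by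
      calc _ ≤ ∑ b, ∑ i, (if G (c i) b then ∑ a, P a * K a b else 0) := by
            refine Finset.sum_le_sum fun b _ => ?_
            have h0 : 0 ≤ ∑ a, P a * K a b :=
              Finset.sum_nonneg fun a _ => mul_nonneg (hP a) (hK a b)
            have h1 : ∀ i, 0 ≤ (if G (c i) b then ∑ a, P a * K a b else 0) := by
              intro i
              split_ifs
              exacts [h0, le_rfl]
            split_ifs with h
            · obtain ⟨i, hi⟩ := Option.ne_none_iff_exists'.1 h
              refine le_trans ?_ (Finset.single_le_sum (fun i _ => h1 i) (Finset.mem_univ i))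
              rw [if_pos (hgood b i hi)]
            · exact Finset.sum_nonneg fun i _ => h1 i
        _ = ∑ i : Fin M, ∑ b, (if G (c i) b then ∑ a, P a * K a b else 0) := Finset.sum_comm
        _ ≤ ∑ _i : Fin M, g := Finset.sum_le_sum fun i _ => hg _
        _ = M * g := by simp
    obtain ⟨a, ha⟩ := exists_codeword (U := fun b => dec b ≠ none) hP hP1 hK hq
      (by convert hU)
      (by push_cast at hM; linarith : (M : ℝ) * g ≤ δ - q)
    -- The new word receives only the part of its good set not yet assigned, so the earlier regions
    -- stay as they are.
    refine ⟨Fin.snoc c a, fun b => (dec b).elim (if G a b then some (Fin.last M) else none)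
      fun i => some i.castSucc, fun i => ?_, fun b i => ?_⟩
    · refine Fin.lastCases ?_ (fun i => ?_) i
      · rw [Fin.snoc_last]
        refine le_trans (Finset.sum_le_sum fun b _ => ?_) ha
        have := hK a b
        cases hb : dec b <;> by_cases hG : G a b <;>
          simp [hb, hG, (Fin.castSucc_lt_last _).ne]
      · rw [Fin.snoc_castSucc]
        refine le_trans (Finset.sum_le_sum fun b _ => ?_) (herr i)
        have := hK (c i) b
        cases hb : dec b <;> by_cases hG : G a b <;>
          simp [hb, hG, (Fin.castSucc_lt_last _).ne']
    · cases hb : dec b with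
      | some k =>
        simp only [hb, Option.elim_some, Option.some.injEq]
        rintro rfl
        rw [Fin.snoc_castSucc]
        exact hgood b k hb
      | none =>
        by_cases hG : G a b
        · simp only [hb, Option.elim_none, hG, if_true, Option.some.injEq]
          rintro rfl
          rwa [Fin.snoc_last]
        · simp [hb, hG]

end

-- Block codes that reject a given input sequence.

namespace Channel

variable {X Y : Type*} [Fintype X] [Fintype Y]

/-- The density `∏ W / ∏ Q` is the exponential of the accumulated log-likelihood ratio. -/
theorem prod_eq_exp_mul_prod {N : ℕ} {a b : Fin N → ℝ} (ha : ∀ t, 0 < a t) (hb : ∀ t, 0 < b t) :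
    ∏ t, a t = exp (∑ t, log (a t / b t)) * ∏ t, b t := by
  rw [exp_sum, ← Finset.prod_mul_distrib]
  refine Finset.prod_congr rfl fun t _ => ?_
  rw [exp_log (div_pos (ha t) (hb t)), div_mul_cancel₀ _ (hb t).ne']

theorem sum_prod_eq_one {Z : Type*} [Fintype Z] {N : ℕ} {p : Fin N → Z → ℝ}
    (hp : ∀ t, ∑ z, p t z = 1) : ∑ z : Fin N → Z, ∏ t, p t (z t) = 1 := by
  have h := Finset.prod_univ_sum (fun _ : Fin N => (Finset.univ : Finset Z)) p
  rw [Fintype.piFinset_univ] at h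
  rw [← h]
  exact Finset.prod_eq_one fun t _ => hp t

theorem sum_prod_mul_eq_prod_output (Ch : Channel X Y) {N : ℕ} (P : Fin N → X → ℝ)
    (y : Fin N → Y) :
    ∑ a : Fin N → X, (∏ t, P t (a t)) * ∏ t, Ch.W (a t) (y t) = ∏ t, Ch.output (P t) (y t) := by
  simp only [← Finset.prod_mul_distrib, output]
  rw [Finset.prod_univ_sum, Fintype.piFinset_univ]

/-- The information density of a random codeword and its output is rarely much smaller than the
mutual information. -/
theorem infoDensity_lower_tail_le (Ch : Channel X Y) [Nonempty X] {N : ℕ} {P : Fin N → X → ℝ}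
    (hP : ∀ t, P t ∈ stdSimplex ℝ X) {s τ : ℝ} (hs : 0 ≤ s) (hsL : 2 * s * Ch.maxLLR ≤ 1) :
    ∑ a : Fin N → X, ∑ y : Fin N → Y,
      (if ∑ t, log (Ch.W (a t) (y t) / Ch.output (P t) (y t)) < ∑ t, Ch.mutualInfo (P t) - τ
        then (∏ t, P t (a t)) * ∏ t, Ch.W (a t) (y t) else 0)
      ≤ exp (-s * τ + s ^ 2 * Ch.maxLLR ^ 2 * N) := by
  have h := sum_prod_lower_tail_le (N := N) (Z := X × Y) (τ := τ) (L := Ch.maxLLR) (s := s)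
    (p := fun t z => P t z.1 * Ch.W z.1 z.2)
    (f := fun t z => log (Ch.W z.1 z.2 / Ch.output (P t) z.2))
    (fun t z => mul_nonneg ((hP t).1 _) (Ch.pos _ _).le)
    (fun t => by
      simp only [Fintype.sum_prod_type, ← Finset.mul_sum, Ch.sum_eq_one, mul_one, (hP t).2])
    (fun t z => Ch.abs_log_div_le (Ch.minProb_le _ _) (Ch.W_le_one _ _)
      (Ch.minProb_le_output (hP t) _) (Ch.output_le_one (hP t) _)) hs hsL
  refine le_trans (le_of_eq ?_) h
  rw [← (Equiv.arrowProdEquivProdArrow (Fin N) (fun _ => X) (fun _ => Y)).symm.sum_comp,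
    Fintype.sum_prod_type]
  simp only [Equiv.arrowProdEquivProdArrow, Equiv.coe_fn_symm_mk, Finset.prod_mul_distrib,
    Fintype.sum_prod_type, mutualInfo]
  congr!

/-- Under the output distribution of a random codeword, the log-likelihood ratio with respect to
the input sequence `u` is rarely much smaller than the divergence. -/
theorem llr_lower_tail_le (Ch : Channel X Y) [Nonempty X] {N : ℕ} {P : Fin N → X → ℝ}
    (hP : ∀ t, P t ∈ stdSimplex ℝ X) (u : Fin N → X) {s τ : ℝ} (hs : 0 ≤ s)
    (hsL : 2 * s * Ch.maxLLR ≤ 1) :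
    ∑ a : Fin N → X, ∑ y : Fin N → Y,
      (if ∑ t, log (Ch.output (P t) (y t) / Ch.W (u t) (y t))
          < ∑ t, klDivergence (Ch.output (P t)) (Ch.W (u t)) - τ
        then (∏ t, P t (a t)) * ∏ t, Ch.W (a t) (y t) else 0)
      ≤ exp (-s * τ + s ^ 2 * Ch.maxLLR ^ 2 * N) := by
  have h := sum_prod_lower_tail_le (N := N) (Z := Y) (τ := τ) (L := Ch.maxLLR) (s := s)
    (p := fun t => Ch.output (P t))
    (f := fun t y => log (Ch.output (P t) y / Ch.W (u t) y))
    (fun t y => (Ch.output_pos (hP t) y).le) (fun t => Ch.sum_output (hP t))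
    (fun t y => Ch.abs_log_div_le (Ch.minProb_le_output (hP t) _) (Ch.output_le_one (hP t) _)
      (Ch.minProb_le _ _) (Ch.W_le_one _ _)) hs hsL
  refine le_trans (le_of_eq ?_) h
  rw [Finset.sum_comm]
  refine Finset.sum_congr rfl fun y _ => ?_
  by_cases hc : ∑ t, log (Ch.output (P t) (y t) / Ch.W (u t) (y t))
      < ∑ t, klDivergence (Ch.output (P t)) (Ch.W (u t)) - τ
  · refine (Finset.sum_congr rfl fun a _ => if_pos hc).trans (Eq.trans ?_ (if_pos hc).symm)
    exact Ch.sum_prod_mul_eq_prod_output P y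
  · exact (Finset.sum_eq_zero fun a _ => if_neg hc).trans (if_neg hc).symm

/-- A block code whose decoder rejects the outputs of the input sequence `u`, and whose codewords
are drawn from the distributions `P t`. -/
theorem exists_code_rejecting (Ch : Channel X Y) [Nonempty X] {N : ℕ} {P : Fin N → X → ℝ}
    (hP : ∀ t, P t ∈ stdSimplex ℝ X) (u : Fin N → X) {s p τ : ℝ} (hs : 0 < s)
    (hsL : 2 * s * Ch.maxLLR ≤ 1) (hp : 0 < p)
    (hτ : τ = s * Ch.maxLLR ^ 2 * N - log p / s) :
    ∃ (M : ℕ) (c : Fin M → Fin N → X) (dec : (Fin N → Y) → Option (Fin M)),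
      p * exp (∑ t, Ch.mutualInfo (P t) - τ) ≤ M ∧
      (∀ i, ∑ y, (if dec y = some i then 0 else ∏ t, Ch.W (c i t) (y t)) ≤ 3 * p) ∧
      ∑ y, (if dec y = none then 0 else ∏ t, Ch.W (u t) (y t)) ≤
        exp (-(∑ t, klDivergence (Ch.output (P t)) (Ch.W (u t)) - τ)) := by
  set γ := ∑ t, Ch.mutualInfo (P t) - τ with hγ
  set θ := ∑ t, klDivergence (Ch.output (P t)) (Ch.W (u t)) - τ with hθ
  -- τ is chosen so that both Chernoff tails equal p exactly.
  have htail : exp (-s * τ + s ^ 2 * Ch.maxLLR ^ 2 * N) = p := by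
    have : -s * τ + s ^ 2 * Ch.maxLLR ^ 2 * N = log p := by
      rw [hτ]
      field_simp
      ring
    rw [this, exp_log hp]
  have hI := Ch.infoDensity_lower_tail_le hP (τ := τ) hs.le hsL
  have hD := Ch.llr_lower_tail_le hP u (τ := τ) hs.le hsL
  rw [htail, ← hγ] at hI
  rw [htail, ← hθ] at hD
  have hQ : ∀ y : Fin N → Y, 0 ≤ ∏ t, Ch.output (P t) (y t) := fun y =>
    Finset.prod_nonneg fun t _ => (Ch.output_pos (hP t) _).le
  have hK : ∀ (a : Fin N → X) (y : Fin N → Y), 0 ≤ ∏ t, Ch.W (a t) (y t) := fun a y =>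
    Finset.prod_nonneg fun t _ => (Ch.pos _ _).le
  have hPa : ∀ a : Fin N → X, 0 ≤ ∏ t, P t (a t) := fun a =>
    Finset.prod_nonneg fun t _ => (hP t).1 _
  obtain ⟨c, dec, herr, hgood⟩ := exists_code_of_good_sets
    (P := fun a : Fin N → X => ∏ t, P t (a t))
    (K := fun (a : Fin N → X) (y : Fin N → Y) => ∏ t, Ch.W (a t) (y t))
    -- The first condition bounds the output mass of a good set, hence the code size; the second
    -- does not involve a and controls acceptance of u.
    (G := fun a y => γ ≤ ∑ t, log (Ch.W (a t) (y t) / Ch.output (P t) (y t)) ∧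
      θ ≤ ∑ t, log (Ch.output (P t) (y t) / Ch.W (u t) (y t)))
    -- The two tails use 2p of the error budget; the remaining p pays for about p e^γ codewords.
    (q := 2 * p) (δ := 3 * p) (g := exp (-γ)) hPa
    (sum_prod_eq_one fun t => (hP t).2) hK
    (by
      rw [two_mul]
      refine le_trans ?_ (add_le_add hI hD)
      simp only [← Finset.sum_add_distrib]
      refine Finset.sum_le_sum fun a _ => Finset.sum_le_sum fun y _ => ?_
      have := mul_nonneg (hPa a) (hK a y)
      simp only [← not_le, ite_not]
      split_ifs <;> first | (simp; done) | linarith | (exfalso; tauto))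
    (exp_pos _).le
    (fun a => by
      calc _ ≤ ∑ y : Fin N → Y, exp (-γ) * ∏ t, Ch.W (a t) (y t) := by
            refine Finset.sum_le_sum fun y _ => ?_
            split_ifs with h
            · rw [sum_prod_mul_eq_prod_output, prod_eq_exp_mul_prod (fun t => Ch.pos (a t) (y t))
                (fun t => Ch.output_pos (hP t) (y t)), ← mul_assoc, ← exp_add]
              exact le_mul_of_one_le_left (hQ y) (one_le_exp (by linarith [h.1]))
            · exact mul_nonneg (exp_pos _).le (hK a y)
        _ = exp (-γ) := by
            rw [← Finset.mul_sum, sum_prod_eq_one fun t => Ch.sum_eq_one (a t), mul_one])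
    ⌈p * exp γ⌉₊
    (by
      have h1 := (Nat.ceil_lt_add_one (a := p * exp γ) (by positivity)).le
      calc ((⌈p * exp γ⌉₊ : ℝ) - 1) * exp (-γ) ≤ p * exp γ * exp (-γ) :=
            mul_le_mul_of_nonneg_right (by linarith) (exp_pos _).le
        _ = 3 * p - 2 * p := by
            rw [mul_assoc, ← exp_add, add_neg_cancel, exp_zero]
            ring)
  refine ⟨_, c, dec, Nat.le_ceil _, herr, ?_⟩
  -- Change of measure: on every decoding region the law of u is at most e^{-θ} times the product
  -- output law.
  calc _ ≤ ∑ y : Fin N → Y, exp (-θ) * ∏ t, Ch.output (P t) (y t) := by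
        refine Finset.sum_le_sum fun y _ => ?_
        split_ifs with h
        · exact mul_nonneg (exp_pos _).le (hQ y)
        · obtain ⟨i, hi⟩ := Option.ne_none_iff_exists'.1 h
          rw [prod_eq_exp_mul_prod (fun t => Ch.output_pos (hP t) (y t))
            (fun t => Ch.pos (u t) (y t)), ← mul_assoc, ← exp_add]
          exact le_mul_of_one_le_left (hK u y) (one_le_exp (by linarith [(hgood y i hi).2]))
    _ = exp (-θ) := by
        rw [← Finset.mul_sum, sum_prod_eq_one fun t => Ch.sum_output (hP t), mul_one]

/-- Time sharing between two values, in a block of length `N` and in the proportion `α`. -/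
theorem exists_le_sum_time_sharing {α : ℝ} (h0 : 0 ≤ α) (h1 : α ≤ 1) (N : ℕ) :
    ∃ k : ℕ, ∀ a b L : ℝ, 0 ≤ a → a ≤ L → 0 ≤ b →
      N * (α * a + (1 - α) * b) - L ≤ ∑ t : Fin N, if (t : ℕ) < k then a else b := by
  have hk : ⌊α * N⌋₊ ≤ N := Nat.floor_le_of_le (by nlinarith [(Nat.cast_nonneg N : (0 : ℝ) ≤ N)])
  -- The split is fixed before a and b because mutual information and divergence must share it.
  -- Rounding loses (αN - k)(a - b) ≤ L.
  refine ⟨⌊α * N⌋₊, fun a b L ha haL hb => ?_⟩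
  have hsum : ∑ t : Fin N, (if (t : ℕ) < ⌊α * N⌋₊ then a else b)
      = ⌊α * N⌋₊ * a + (N - ⌊α * N⌋₊) * b := by
    rw [Fin.sum_univ_eq_sum_range (fun t => if t < ⌊α * N⌋₊ then a else b) N,
      ← Finset.sum_range_add_sum_Ico _ hk,
      Finset.sum_congr rfl fun t ht => if_pos (Finset.mem_range.1 ht),
      Finset.sum_congr (g := fun _ => b) rfl
        fun t ht => if_neg (Finset.mem_Ico.1 ht).1.not_gt]
    simp [Nat.cast_sub hk]
  rw [hsum]
  have h2 := Nat.lt_floor_add_one (α * N)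
  have h3 := Nat.floor_le (a := α * N) (by positivity)
  nlinarith

/-- A block code of length `N` of rate about `R` that rejects a suitable input sequence with an
exponent of about `J R`. -/
theorem exists_code_rejecting_J (Ch : Channel X Y) [Nonempty X] {R κ s p τ : ℝ}
    (hR : R ≤ Ch.capacity) (hκ : 0 < κ) (N : ℕ) (hs : 0 < s) (hsL : 2 * s * Ch.maxLLR ≤ 1)
    (hp : 0 < p) (hτ : τ = s * Ch.maxLLR ^ 2 * N - log p / s) :
    ∃ (M : ℕ) (u : Fin N → X) (c : Fin M → Fin N → X) (dec : (Fin N → Y) → Option (Fin M))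
      (v : ℝ), 0 ≤ v ∧ v ≤ Ch.maxLLR ∧ Ch.J R - κ ≤ v ∧
      p * exp (N * R - Ch.maxLLR - τ) ≤ M ∧
      (∀ i, ∑ y, (if dec y = some i then 0 else ∏ t, Ch.W (c i t) (y t)) ≤ 3 * p) ∧
      ∑ y, (if dec y = none then 0 else ∏ t, Ch.W (u t) (y t)) ≤
        exp (-(N * v - Ch.maxLLR - τ)) := by
  obtain ⟨α, x₁, x₂, P₁, P₂, h0, h1, hP₁, hP₂, hle, hv⟩ := Ch.exists_lt_of_lt_J hR hκ
  obtain ⟨k, hk⟩ := exists_le_sum_time_sharing h0 h1 N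
  have hI := hk _ _ _ (Ch.mutualInfo_nonneg hP₁) (Ch.mutualInfo_le hP₁) (Ch.mutualInfo_nonneg hP₂)
  have hD := hk _ _ _ (Ch.klDivergence_output_nonneg hP₁ x₁) (Ch.klDivergence_output_le hP₁ x₁)
    (Ch.klDivergence_output_nonneg hP₂ x₂)
  obtain ⟨M, c, dec, hM, herr, hrej⟩ := Ch.exists_code_rejecting (N := N)
    (P := fun t => if (t : ℕ) < k then P₁ else P₂)
    (fun t => by split_ifs; exacts [hP₁, hP₂])
    (fun t => if (t : ℕ) < k then x₁ else x₂) hs hsL hp hτ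
  have e1 : ∀ t : Fin N, Ch.mutualInfo (if (t : ℕ) < k then P₁ else P₂)
      = if (t : ℕ) < k then Ch.mutualInfo P₁ else Ch.mutualInfo P₂ := fun t => apply_ite _ _ _ _
  have e2 : ∀ t : Fin N, klDivergence (Ch.output (if (t : ℕ) < k then P₁ else P₂))
      (Ch.W (if (t : ℕ) < k then x₁ else x₂)) = if (t : ℕ) < k
        then klDivergence (Ch.output P₁) (Ch.W x₁) else klDivergence (Ch.output P₂) (Ch.W x₂) := by
    intro t
    split_ifs <;> rfl
  simp only [e1] at hM
  simp only [e2] at hrej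
  have hN : (0 : ℝ) ≤ N := Nat.cast_nonneg N
  have a1 := Ch.klDivergence_output_nonneg hP₁ x₁
  have a2 := Ch.klDivergence_output_nonneg hP₂ x₂
  have b1 := Ch.klDivergence_output_le hP₁ x₁
  have b2 := Ch.klDivergence_output_le hP₂ x₂
  -- v is the value at the near-optimal feasible point, so it lies in [0, L] without any bound on J
  -- itself.
  refine ⟨M, _, c, dec, _, ?_, ?_, hv.le, ?_, herr, hrej.trans (exp_le_exp.2 ?_)⟩
  · exact add_nonneg (mul_nonneg h0 a1) (mul_nonneg (by linarith) a2)
  · nlinarith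
  · refine le_trans (mul_le_mul_of_nonneg_left (exp_le_exp.2 ?_) hp.le) hM
    have := mul_le_mul_of_nonneg_left hle hN
    linarith
  · linarith

end Channel

-- Decomposition by the first failing stage.

section FirstFailure

variable {k : ℕ} {B : Fin k → Type*} [∀ j, Fintype (B j)]

/-- A process of `k` stages, in which stage `j` has law `F j` if all earlier stages were successful
and law `V j` otherwise: the probability that stage `i` is the first one that fails and that the
later stages satisfy `h`. -/
theorem sum_first_failure_le {F V : ∀ j, B j → ℝ} {g h : ∀ j, B j → Prop} {δ : ℝ} {β : Fin k → ℝ}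
    (hF : ∀ j b, 0 ≤ F j b) (hV : ∀ j b, 0 ≤ V j b) (hF1 : ∀ j, ∑ b, F j b = 1) (i : Fin k)
    (hδ : ∑ b, (if g i b then 0 else F i b) ≤ δ)
    (hβ : ∀ j, i < j → ∑ b, (if h j b then V j b else 0) ≤ β j) :
    ∑ b : ∀ j, B j, (if (∀ j < i, g j (b j)) ∧ ¬ g i (b i) ∧ ∀ j, i < j → h j (b j) then
        ∏ j, (if ∀ l < j, g l (b l) then F j (b j) else V j (b j)) else 0)
      ≤ δ * ∏ j ∈ Finset.Ioi i, β j := by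
  -- On the event the history is known at each stage: law F up to i, law V after i. The weight
  -- therefore becomes a product of one-stage factors, and the sum factorises.
  set φ : ∀ j, B j → ℝ := fun j b =>
    if j < i then F j b else if j = i then (if g j b then 0 else F j b)
      else if h j b then V j b else 0 with hφ
  have hφ0 : ∀ j b, 0 ≤ φ j b := by
    intro j b
    simp only [hφ]
    split_ifs <;> first | exact hF j b | exact hV j b | exact le_rfl
  have hle : ∀ j, ∑ b, φ j b ≤ if j < i then 1 else if j = i then δ else β j := by
    intro j
    rcases lt_trichotomy j i with hj | rfl | hj
    · simp [hφ, hj, hF1]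
    · simpa [hφ] using hδ
    · simpa [hφ, hj.not_gt, hj.ne'] using hβ j hj
  calc _ ≤ ∑ b : ∀ j, B j, ∏ j, φ j (b j) := by
        refine Finset.sum_le_sum fun b _ => ?_
        split_ifs with hb
        · obtain ⟨h1, h2, h3⟩ := hb
          refine le_of_eq (Finset.prod_congr rfl fun j _ => ?_)
          rcases lt_trichotomy j i with hj | rfl | hj
          · rw [if_pos fun l hl => h1 l (hl.trans hj)]
            simp [hφ, hj]
          · rw [if_pos h1]
            simp [hφ, h2]
          · rw [if_neg fun hc => h2 (hc i hj)]
            simp [hφ, hj.not_gt, hj.ne', h3 j hj]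
        · exact Finset.prod_nonneg fun j _ => hφ0 j _
    _ = ∏ j, ∑ b, φ j b := by rw [Finset.prod_univ_sum, Fintype.piFinset_univ]
    _ ≤ ∏ j, (if j < i then 1 else if j = i then δ else β j) :=
        Finset.prod_le_prod (fun j _ => Finset.sum_nonneg fun b _ => hφ0 j b) fun j _ => hle j
    _ = δ * ∏ j ∈ Finset.Ioi i, β j := by
        rw [← Finset.mul_prod_erase _ _ (Finset.mem_univ i)]
        congr 1
        · simp
        · refine (Finset.prod_subset (s₁ := Finset.Ioi i) (fun j hj => ?_)
            fun j hj hj' => ?_).symm.trans (Finset.prod_congr rfl fun j hj => ?_)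
          · simpa using (Finset.mem_Ioi.1 hj).ne'
          · have h1 : j ≠ i := (Finset.mem_erase.1 hj).1
            have h2 : j < i := lt_of_le_of_ne (not_lt.1 fun h => hj' (Finset.mem_Ioi.2 h)) h1
            simp [h2]
          · have hj := Finset.mem_Ioi.1 hj
            simp [hj.not_gt, hj.ne']

end FirstFailure

-- Concatenation of block codes with feedback.

theorem sum_castLE_le {k : ℕ} (N : Fin k → ℕ) {a b : Fin k} (hab : a < b) :
    ∑ i : Fin (a : ℕ), N (Fin.castLE a.2.le i) + N a
      ≤ ∑ i : Fin (b : ℕ), N (Fin.castLE b.2.le i) := by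
  have h : ∀ c : Fin k, ∑ i : Fin (c : ℕ), N (Fin.castLE c.2.le i)
      = ∑ i ∈ Finset.range c, (if h : i < k then N ⟨i, h⟩ else 0) := by
    intro c
    rw [← Fin.sum_univ_eq_sum_range (fun i => if h : i < k then N ⟨i, h⟩ else 0)]
    refine Finset.sum_congr rfl fun i _ => ?_
    rw [dif_pos (i.2.trans c.2)]
    rfl
  have h1 := Finset.sum_range_succ (fun i => if h : i < k then N ⟨i, h⟩ else 0) a
  simp only [a.2, dif_pos] at h1
  rw [h, h, ← h1]
  exact Finset.sum_le_sum_of_subset (Finset.range_subset_range.2 hab)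

/-- Causality: an earlier block is complete before a later one starts, so its decision is available
to the feedback encoder. -/
theorem finSigmaFinEquiv_lt {k : ℕ} {N : Fin k → ℕ} {a b : Fin k} (hab : a < b) (s : Fin (N a))
    (t : Fin (N b)) :
    (finSigmaFinEquiv (⟨a, s⟩ : (j : Fin k) × Fin (N j)) : ℕ) <
      (finSigmaFinEquiv (⟨b, t⟩ : (j : Fin k) × Fin (N j)) : ℕ) := by
  rw [finSigmaFinEquiv_apply, finSigmaFinEquiv_apply]
  have := sum_castLE_le N hab
  have := s.2
  dsimp only
  omega

/-- Splitting a sequence into consecutive blocks of lengths `N j`. -/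
def splitBlocks (Y : Type*) {k : ℕ} (N : Fin k → ℕ) :
    (Fin (∑ j, N j) → Y) ≃ (∀ j, Fin (N j) → Y) :=
  (Equiv.arrowCongr finSigmaFinEquiv.symm (Equiv.refl Y)).trans
    (Equiv.piCurry fun (j : Fin k) (_ : Fin (N j)) => Y)

section Concatenation

variable {X Y : Type*} [Fintype Y] {k : ℕ} (N M : Fin k → ℕ)
  (u : ∀ j, Fin (N j) → X) (c : ∀ j, Fin (M j) → Fin (N j) → X)
  (dec : ∀ j, (Fin (N j) → Y) → Option (Fin (M j)))

/-- Consecutive transmission of the sub-messages with block codes. Once some sub-message has been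
decoded incorrectly, the encoder sends the reject words `u j` in all later blocks. The decoder
declares an erasure if some block is rejected. -/
noncomputable def concatCode (y₀ : Y) : FeedbackCode X Y (∀ j, Fin (M j)) (∑ j, N j) where
  enc m t y :=
    if ∀ l < (finSigmaFinEquiv.symm t).1, dec l (fun s =>
      -- The default y₀ only makes the expression total; for l before the current block the
      -- condition always holds.
      if h : (finSigmaFinEquiv (⟨l, s⟩ : (j : Fin k) × Fin (N j)) : ℕ) < t then y ⟨_, h⟩ else y₀)
        = some (m l)
    then c _ (m _) (finSigmaFinEquiv.symm t).2 else u _ (finSigmaFinEquiv.symm t).2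
  dec y :=
    if h : ∀ j, (dec j (splitBlocks Y N y j)).isSome
    then some fun j => (dec j (splitBlocks Y N y j)).get (h j) else none

omit [Fintype Y] in
theorem concatCode_enc (y₀ : Y) (m : ∀ j, Fin (M j)) (y : Fin (∑ j, N j) → Y) (j : Fin k)
    (s : Fin (N j)) :
    (concatCode N M u c dec y₀).enc m (finSigmaFinEquiv ⟨j, s⟩)
        (fun t => y (Fin.castLE (finSigmaFinEquiv ⟨j, s⟩).isLt.le t))
      = if ∀ l < j, dec l (splitBlocks Y N y l) = some (m l) then c j (m j) s else u j s := by
  have hpast : ∀ l < j, (fun s' => if h : (finSigmaFinEquiv (⟨l, s'⟩ : (j : Fin k) × Fin (N j)) : ℕ)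
      < (finSigmaFinEquiv (⟨j, s⟩ : (j : Fin k) × Fin (N j)) : ℕ) then
        (fun t : Fin (finSigmaFinEquiv (⟨j, s⟩ : (j : Fin k) × Fin (N j)) : ℕ) =>
          y (Fin.castLE (finSigmaFinEquiv (⟨j, s⟩ : (j : Fin k) × Fin (N j))).isLt.le t)) ⟨_, h⟩
      else y₀) = splitBlocks Y N y l := by
    intro l hl
    funext s'
    rw [dif_pos (finSigmaFinEquiv_lt hl s' s)]
    rfl
  simp only [concatCode]
  -- The types of the codewords depend on this index, so the round trip is replaced as a whole
  -- before substitution.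
  generalize hp : finSigmaFinEquiv.symm (finSigmaFinEquiv ⟨j, s⟩) = p
  rw [Equiv.symm_apply_apply] at hp
  subst hp
  refine if_congr (forall₂_congr fun l hl => ?_) rfl rfl
  rw [hpast l hl]

/-- This puts the path law into the stage-by-stage form of `sum_first_failure_le`, with a failure
switching the law of all later blocks. -/
theorem pathProb_concatCode (Ch : Channel X Y) (y₀ : Y) (m : ∀ j, Fin (M j))
    (y : Fin (∑ j, N j) → Y) :
    (concatCode N M u c dec y₀).pathProb Ch m y =
      ∏ j, if ∀ l < j, dec l (splitBlocks Y N y l) = some (m l)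
        then ∏ s, Ch.W (c j (m j) s) (splitBlocks Y N y j s)
        else ∏ s, Ch.W (u j s) (splitBlocks Y N y j s) := by
  rw [FeedbackCode.pathProb, ← finSigmaFinEquiv.prod_comp, Fintype.prod_sigma]
  refine Finset.prod_congr rfl fun j _ => ?_
  simp only [concatCode_enc]
  split_ifs <;> rfl

variable {N M u c dec}

/-- The probability that block `i` is the first that is decoded incorrectly and that none of the
blocks in `S` after `i` is rejected. -/
theorem condProb_concatCode_le (Ch : Channel X Y) {δ β : Fin k → ℝ} (y₀ : Y)
    (herr : ∀ j w, ∑ y, (if dec j y = some w then 0 else ∏ t, Ch.W (c j w t) (y t)) ≤ δ j)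
    (hrej : ∀ j, ∑ y, (if dec j y = none then 0 else ∏ t, Ch.W (u j t) (y t)) ≤ β j)
    (m : ∀ j, Fin (M j)) (i : Fin k) (S : Finset (Fin k)) (hS : ∀ j ∈ S, i < j) :
    (concatCode N M u c dec y₀).condProb Ch m {y | (∀ j < i, dec j (splitBlocks Y N y j) = some (m j))
      ∧ dec i (splitBlocks Y N y i) ≠ some (m i) ∧ ∀ j ∈ S, dec j (splitBlocks Y N y j) ≠ none}
      ≤ δ i * ∏ j ∈ S, β j := by
  have h := sum_first_failure_le (B := fun j => Fin (N j) → Y)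
    (F := fun j y => ∏ t, Ch.W (c j (m j) t) (y t)) (V := fun j y => ∏ t, Ch.W (u j t) (y t))
    (g := fun j y => dec j y = some (m j)) (h := fun j y => j ∈ S → dec j y ≠ none) (δ := δ i)
    -- Blocks outside S carry no requirement and contribute the factor 1.
    (β := fun j => if j ∈ S then β j else 1)
    (fun j y => Finset.prod_nonneg fun t _ => (Ch.pos _ _).le)
    (fun j y => Finset.prod_nonneg fun t _ => (Ch.pos _ _).le)
    (fun j => Channel.sum_prod_eq_one fun t => Ch.sum_eq_one _) i
    (by convert herr i (m i))
    (fun j _ => by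
      by_cases hj : j ∈ S
      · simpa [hj] using hrej j
      · simpa [hj] using (Channel.sum_prod_eq_one fun t => Ch.sum_eq_one (u j t)).le)
  have hprod : ∏ j ∈ Finset.Ioi i, (if j ∈ S then β j else 1) = ∏ j ∈ S, β j := by
    rw [Finset.prod_ite_mem, Finset.inter_eq_right.2 fun j hj => Finset.mem_Ioi.2 (hS j hj)]
  rw [hprod] at h
  refine le_trans (le_of_eq ?_) h
  rw [← (splitBlocks Y N).sum_comp, FeedbackCode.condProb]
  refine Finset.sum_congr rfl fun y _ => ?_
  simp only [Set.indicator_apply, Set.mem_ofPred_eq, pathProb_concatCode]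
  have hiff : (∀ j ∈ S, dec j (splitBlocks Y N y j) ≠ none) ↔
      ∀ j, i < j → j ∈ S → dec j (splitBlocks Y N y j) ≠ none :=
    ⟨fun h j _ => h j, fun h j hj => h j (hS j hj) hj⟩
  congr! 1
  · exact and_congr_right' (and_congr_right' hiff)
  · congr!

theorem condProb_mono_union {Msg : Type*} {n : ℕ} (code : FeedbackCode X Y Msg n)
    (Ch : Channel X Y) (m : Msg) {ι : Type*} (T : Finset ι) {A : Set (Fin n → Y)}
    {E : ι → Set (Fin n → Y)} (h : ∀ y ∈ A, ∃ i ∈ T, y ∈ E i) :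
    code.condProb Ch m A ≤ ∑ i ∈ T, code.condProb Ch m (E i) := by
  simp only [FeedbackCode.condProb]
  rw [Finset.sum_comm]
  have h0 : ∀ y, 0 ≤ code.pathProb Ch m y := fun y => Finset.prod_nonneg fun t _ => (Ch.pos _ _).le
  refine Finset.sum_le_sum fun y _ => ?_
  by_cases hy : y ∈ A
  · obtain ⟨i, hi, hyi⟩ := h y hy
    rw [Set.indicator_of_mem hy, ← Set.indicator_of_mem hyi (code.pathProb Ch m)]
    exact Finset.single_le_sum
      (f := fun i => (E i).indicator (code.pathProb Ch m) y)
      (fun i _ => Set.indicator_nonneg (fun y _ => h0 y) y) hi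
  · rw [Set.indicator_of_notMem hy]
    exact Finset.sum_nonneg fun i _ => Set.indicator_nonneg (fun y _ => h0 y) y

/-- If every block is decoded correctly there is no erasure, so some block is the first failure. The
union bound with S = ∅ then sums the block errors. -/
theorem erasureProb_concatCode_le (Ch : Channel X Y) {δ β : Fin k → ℝ} (y₀ : Y)
    (herr : ∀ j w, ∑ y, (if dec j y = some w then 0 else ∏ t, Ch.W (c j w t) (y t)) ≤ δ j)
    (hrej : ∀ j, ∑ y, (if dec j y = none then 0 else ∏ t, Ch.W (u j t) (y t)) ≤ β j)
    (m : ∀ j, Fin (M j)) :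
    (concatCode N M u c dec y₀).erasureProb Ch m ≤ ∑ j, δ j := by
  refine (condProb_mono_union _ Ch m Finset.univ fun y hy => ?_).trans <|
    Finset.sum_le_sum fun i _ =>
      (condProb_concatCode_le Ch y₀ herr hrej m i ∅ (by simp)).trans (by simp)
  have hex : ∃ j, dec j (splitBlocks Y N y j) ≠ some (m j) := by
    by_contra! hcon
    simp [concatCode, hcon] at hy
  obtain ⟨i, hi, hmin⟩ := WellFounded.has_min (wellFounded_lt (α := Fin k)) _ hex
  exact ⟨i, Finset.mem_univ i, fun j hj => by_contra fun h => hmin j h hj, hi, by simp⟩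

/-- The first failure a satisfies a ≤ i, and without an erasure no block is rejected. Using this
only for blocks after i gives the same product for every a, which factors out of the union bound. -/
theorem prefixErrorProb_concatCode_le (Ch : Channel X Y) {δ β : Fin k → ℝ} (y₀ : Y)
    (herr : ∀ j w, ∑ y, (if dec j y = some w then 0 else ∏ t, Ch.W (c j w t) (y t)) ≤ δ j)
    (hrej : ∀ j, ∑ y, (if dec j y = none then 0 else ∏ t, Ch.W (u j t) (y t)) ≤ β j)
    (m : ∀ j, Fin (M j)) (i : Fin k) :
    (concatCode N M u c dec y₀).prefixErrorProb Ch m i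
      ≤ (∑ j ∈ Finset.Iic i, δ j) * ∏ j ∈ Finset.Ioi i, β j := by
  rw [Finset.sum_mul]
  refine (condProb_mono_union _ Ch m (Finset.Iic i) fun y hy => ?_).trans <|
    Finset.sum_le_sum fun l hl => condProb_concatCode_le Ch y₀ herr hrej m l (Finset.Ioi i)
      fun j hj => (Finset.mem_Iic.1 hl).trans_lt (Finset.mem_Ioi.1 hj)
  obtain ⟨m', hm', l, hl, hne⟩ := hy
  simp only [concatCode] at hm'
  split_ifs at hm' with hsome
  obtain rfl := Option.some.inj hm'
  have hl' : dec l (splitBlocks Y N y l) ≠ some (m l) := by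
    intro h
    simp [h] at hne
  obtain ⟨a, ha, hmin⟩ := WellFounded.has_min (wellFounded_lt (α := Fin k))
    {j | dec j (splitBlocks Y N y j) ≠ some (m j)} ⟨l, hl'⟩
  exact ⟨a, Finset.mem_Iic.2 ((not_lt.1 (hmin l hl')).trans hl),
    fun j hj => by_contra fun h => hmin j h hj, ha,
    fun j _ => Option.isSome_iff_ne_none.1 (hsome j)⟩

end Concatenation

/-- Concatenation of `ℓ` block codes and a final block that only confirms or rejects. -/
theorem exists_feedbackCode {X Y : Type*} [Fintype X] [Nonempty X] [Fintype Y] (Ch : Channel X Y)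
    {n ℓ : ℕ} (N M : Fin (ℓ + 1) → ℕ) (hN : ∑ j, N j = n) (hM : 0 < M (Fin.last ℓ))
    (u : ∀ j, Fin (N j) → X) (c : ∀ j, Fin (M j) → Fin (N j) → X)
    (dec : ∀ j, (Fin (N j) → Y) → Option (Fin (M j))) {δ β : Fin (ℓ + 1) → ℝ}
    (herr : ∀ j w, ∑ y, (if dec j y = some w then 0 else ∏ t, Ch.W (c j w t) (y t)) ≤ δ j)
    (hrej : ∀ j, ∑ y, (if dec j y = none then 0 else ∏ t, Ch.W (u j t) (y t)) ≤ β j) :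
    ∃ code : FeedbackCode X Y (∀ j : Fin ℓ, Fin (M j.castSucc)) n,
      (∀ m i, code.prefixErrorProb Ch m i ≤
        (∑ j ∈ Finset.Iic i.castSucc, δ j) * ∏ j ∈ Finset.Ioi i.castSucc, β j) ∧
      ∀ m, code.erasureProb Ch m ≤ ∑ j, δ j := by
  subst hN
  obtain ⟨y₀⟩ := Ch.nonempty_output
  -- The last phase always carries the dummy message 0, discarded after decoding; its role is to
  -- send either that codeword or the reject word.
  let full : (∀ j : Fin ℓ, Fin (M j.castSucc)) → ∀ j, Fin (M j) := fun m =>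
    Fin.snoc (α := fun j => Fin (M j)) m ⟨0, hM⟩
  obtain ⟨code, hcode⟩ : ∃ code, code = concatCode N M u c dec y₀ := ⟨_, rfl⟩
  have herase := erasureProb_concatCode_le Ch y₀ herr hrej
  have hprefix := prefixErrorProb_concatCode_le Ch y₀ herr hrej
  rw [← hcode] at herase hprefix
  let code' : FeedbackCode X Y (∀ j : Fin ℓ, Fin (M j.castSucc)) (∑ j, N j) :=
    ⟨fun m => code.enc (full m), fun y => (code.dec y).map fun m j => m j.castSucc⟩
  have hcond : ∀ m A, code'.condProb Ch m A = code.condProb Ch (full m) A := fun m A => rfl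
  refine ⟨code', fun m i => le_trans ?_ (hprefix (full m) i.castSucc), fun m => ?_⟩
  · rw [FeedbackCode.prefixErrorProb, FeedbackCode.prefixErrorProb, hcond]
    refine le_trans (condProb_mono_union code Ch (full m) (Finset.univ : Finset Unit)
      (E := fun _ => {y | ∃ m', code.dec y = some m' ∧ ∃ j ≤ i.castSucc, m' j ≠ full m j})
      fun y hy => ⟨(), Finset.mem_univ _, ?_⟩)
      (by rw [Finset.univ_unique, Finset.sum_singleton])
    obtain ⟨m', hm', j, hj, hne⟩ := hy
    obtain ⟨m'', hm'', rfl⟩ := Option.map_eq_some_iff.1 hm'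
    exact ⟨m'', hm'', j.castSucc, Fin.castSucc_le_castSucc_iff.2 hj, by simpa [full] using hne⟩
  · refine le_trans (le_of_eq ?_) (herase (full m))
    rw [FeedbackCode.erasureProb, FeedbackCode.erasureProb, hcond]
    simp only [code', Option.map_eq_none_iff]

-- Phase lengths and the coding theorem with free parameters.

theorem sum_Ioi_castSucc {ℓ : ℕ} (f : Fin (ℓ + 1) → ℝ) (i : Fin ℓ) :
    ∑ j ∈ Finset.Ioi i.castSucc, f j = ∑ j ∈ Finset.Ioi i, f j.castSucc + f (Fin.last ℓ) := by
  have h : ∀ (k : ℕ) (a : Fin k) (g : Fin k → ℝ),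
      ∑ j ∈ Finset.Ioi a, g j = ∑ j, if a < j then g j else 0 := by
    intro k a g
    rw [← Finset.sum_filter]
    congr 1
    ext j
    simp
  rw [h, h, Fin.sum_univ_castSucc]
  simp [Fin.castSucc_lt_last]

/-- Rounding the phase lengths `a j` to natural numbers with the same total length. -/
theorem exists_phase_lengths {n ℓ : ℕ} {a : Fin (ℓ + 1) → ℝ} (ha : ∀ j, 0 ≤ a j)
    (hsum : ∑ j, a j = n) :
    ∃ N : Fin (ℓ + 1) → ℕ, ∑ j, N j = n ∧ (∀ j, a j ≤ N j + 1) ∧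
      ∀ j : Fin ℓ, (N j.castSucc : ℝ) ≤ a j.castSucc := by
  rw [Fin.sum_univ_castSucc] at hsum
  have hfl : ∀ j : Fin ℓ, (⌊a j.castSucc⌋₊ : ℝ) ≤ a j.castSucc := fun j => Nat.floor_le (ha _)
  have hle : ((∑ j : Fin ℓ, ⌊a j.castSucc⌋₊ : ℕ) : ℝ) ≤ ∑ j : Fin ℓ, a j.castSucc := by
    push_cast
    exact Finset.sum_le_sum fun j _ => hfl j
  have hle' : ∑ j : Fin ℓ, ⌊a j.castSucc⌋₊ ≤ n := by
    have := ha (Fin.last ℓ)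
    exact_mod_cast (by linarith : ((∑ j : Fin ℓ, ⌊a j.castSucc⌋₊ : ℕ) : ℝ) ≤ n)
  -- Rounding down the first ℓ lengths leaves the surplus to the last phase, whose rate is 0.
  refine ⟨Fin.snoc (α := fun _ => ℕ) (fun j : Fin ℓ => ⌊a j.castSucc⌋₊)
    (n - ∑ j : Fin ℓ, ⌊a j.castSucc⌋₊), ?_, fun j => ?_, fun j => ?_⟩
  · simp only [Fin.sum_univ_castSucc, Fin.snoc_castSucc, Fin.snoc_last]
    omega
  · refine Fin.lastCases ?_ (fun j => ?_) j
    · rw [Fin.snoc_last, Nat.cast_sub hle']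
      linarith
    · rw [Fin.snoc_castSucc]
      exact (Nat.lt_floor_add_one _).le
  · rw [Fin.snoc_castSucc]
    exact hfl j

/-- The coding theorem with free parameters: `s` from the Chernoff bounds, `p` bounding the tail
probabilities, and `κ` the accuracy in the maximisation that defines `J`. -/
theorem exists_feedbackCode_of_params {X Y : Type*} [Fintype X] [Nonempty X] [Fintype Y]
    (Ch : Channel X Y) {n ℓ : ℕ} {R η : Fin ℓ → ℝ} (hR : ∀ i, R i ≤ Ch.capacity * η i)
    (hη : ∀ i, 0 ≤ η i) (hsum : ∑ i, η i ≤ 1) {s p κ T : ℝ} (hs : 0 < s)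
    (hsL : 2 * s * Ch.maxLLR ≤ 1) (hp : 0 < p) (hp1 : p ≤ 1) (hκ : 0 < κ)
    (hT : (ℓ + 1) * (2 * Ch.maxLLR) + s * Ch.maxLLR ^ 2 * n + (ℓ + 1) * (-log p / s)
      + (ℓ + 1) * (-log p) + n * κ ≤ T) :
    ∃ (M : Fin ℓ → ℕ) (code : FeedbackCode X Y (∀ j, Fin (M j)) n),
      (∀ i, exp (n * R i - T) ≤ M i) ∧
      (∀ i, exp (n * ∑ j ∈ Finset.Iic i, R j - T) ≤ ∏ j ∈ Finset.Iic i, (M j : ℝ)) ∧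
      (∀ m i, code.prefixErrorProb Ch m i ≤ (ℓ + 1) * (3 * p) *
        exp (T - n * (∑ j ∈ Finset.Ioi i, η j * Ch.J (R j / η j)
          + (1 - ∑ j, η j) * Ch.J 0))) ∧
      ∀ m, code.erasureProb Ch m ≤ (ℓ + 1) * (3 * p) := by
  have hL := Ch.maxLLR_nonneg
  have hC := Ch.capacity_nonneg
  have hCL := Ch.capacity_le
  have hn : (0 : ℝ) ≤ n := Nat.cast_nonneg n
  have hlp : 0 ≤ -log p := by linarith [log_nonpos hp.le hp1]
  set L := Ch.maxLLR with hLdef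
  let a : Fin (ℓ + 1) → ℝ := Fin.snoc (α := fun _ => ℝ) (fun j => n * η j) (n * (1 - ∑ j, η j))
  let ρ : Fin (ℓ + 1) → ℝ := Fin.snoc (α := fun _ => ℝ) (fun j => R j / η j) 0
  have ha : ∀ j, 0 ≤ a j := by
    intro j
    refine Fin.lastCases ?_ (fun j => ?_) j
    · simpa [a] using mul_nonneg hn (sub_nonneg.2 hsum)
    · simpa [a] using mul_nonneg hn (hη j)
  have hasum : ∑ j, a j = n := by
    simp only [a, Fin.sum_univ_castSucc, Fin.snoc_castSucc, Fin.snoc_last, ← Finset.mul_sum]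
    ring
  have hρ : ∀ j, ρ j ≤ Ch.capacity := by
    intro j
    refine Fin.lastCases ?_ (fun j => ?_) j
    · simpa [ρ] using hC
    · simp only [ρ, Fin.snoc_castSucc]
      exact div_le_of_le_mul₀ (hη j) hC (hR j)
  obtain ⟨N, hN, haN, hNa⟩ := exists_phase_lengths ha hasum
  let τ : Fin (ℓ + 1) → ℝ := fun j => s * L ^ 2 * N j - log p / s
  have hτ : ∀ j, 0 ≤ τ j := fun j => by
    have : 0 ≤ -log p / s := div_nonneg hlp hs.le
    have : 0 ≤ s * L ^ 2 * N j := by positivity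
    simp only [τ]
    linarith [neg_div s (log p)]
  choose M u c dec v hv0 hvL hvJ hM herr hrej using fun j =>
    Ch.exists_code_rejecting_J (hρ j) hκ (N j) hs hsL hp (rfl : τ j = _)
  have hMlast : 0 < M (Fin.last ℓ) := by
    have := lt_of_lt_of_le (mul_pos hp (exp_pos _)) (hM (Fin.last ℓ))
    exact_mod_cast this
  obtain ⟨code, hpre, hera⟩ := exists_feedbackCode Ch N M hN hMlast u c dec
    (δ := fun _ => 3 * p) herr hrej
  -- One loss covers both rate and exponent: L for time sharing, L for length rounding, τ for the
  -- tails, -log p for the code size, aκ for near-optimality in J. Since each loss is nonnegative, T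
  -- bounds every partial sum.
  let loss : Fin (ℓ + 1) → ℝ := fun j => 2 * L + τ j - log p + a j * κ
  have hloss : ∀ j, 0 ≤ loss j := fun j => by
    have := mul_nonneg (ha j) hκ.le
    have := hτ j
    simp only [loss]
    linarith
  have hlossT : ∑ j, loss j ≤ T := by
    refine le_trans (le_of_eq ?_) hT
    have hNs : ∑ j, (N j : ℝ) = n := by exact_mod_cast hN
    simp only [loss, τ, Finset.sum_add_distrib, Finset.sum_sub_distrib, ← Finset.sum_mul, hasum,
      ← Finset.mul_sum, hNs, Finset.sum_const, Finset.card_univ, Fintype.card_fin, nsmul_eq_mul]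
    push_cast
    ring
  have hrate : ∀ j : Fin ℓ, exp (n * R j - loss j.castSucc) ≤ M j.castSucc := by
    intro j
    refine le_trans ?_ (hM j.castSucc)
    nth_rewrite 1 [← exp_log hp]
    rw [← exp_add, exp_le_exp]
    have h1 : n * R j ≤ a j.castSucc * ρ j.castSucc := by
      simp only [a, ρ, Fin.snoc_castSucc, mul_assoc]
      refine mul_le_mul_of_nonneg_left ?_ hn
      -- For η_j = 0 the quotient is 0 and the rate hypothesis gives R_j ≤ 0.
      rcases eq_or_ne (η j) 0 with h0 | h0
      · simpa [h0] using hR j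
      · rw [mul_div_cancel₀ _ h0]
    have h2 : a j.castSucc * ρ j.castSucc ≤ N j.castSucc * ρ j.castSucc + L := by
      have := haN j.castSucc
      have := hNa j
      have := hρ j.castSucc
      -- Nonnegative rates use a ≤ N + 1 and ρ ≤ C ≤ L; negative rates use N ≤ a.
      rcases le_total 0 (ρ j.castSucc) with h | h <;> nlinarith
    have := mul_nonneg (ha j.castSucc) hκ.le
    simp only [loss]
    linarith
  have hβ : ∀ j, exp (-(N j * v j - L - τ j)) ≤ exp (loss j - a j * Ch.J (ρ j)) := by
    intro j
    rw [exp_le_exp]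
    have h1 := mul_le_mul_of_nonneg_left (hvJ j) (ha j)
    have h2 := mul_le_mul_of_nonneg_right (haN j) (hv0 j)
    have := hvL j
    simp only [loss]
    linarith
  refine ⟨fun j => M j.castSucc, code, fun i => ?_, fun i => ?_, fun m i => ?_, fun m => ?_⟩
  · refine le_trans (exp_le_exp.2 ?_) (hrate i)
    have := Finset.single_le_sum (fun j _ => hloss j) (Finset.mem_univ i.castSucc)
    linarith
  · calc _ ≤ exp (∑ j ∈ Finset.Iic i, (n * R j - loss j.castSucc)) := by
          rw [exp_le_exp, Finset.sum_sub_distrib, Finset.mul_sum]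
          have h1 : ∑ j ∈ Finset.Iic i, loss j.castSucc ≤ ∑ j : Fin ℓ, loss j.castSucc :=
            Finset.sum_le_sum_of_subset_of_nonneg (Finset.subset_univ _) fun j _ _ => hloss _
          have h2 := Fin.sum_univ_castSucc loss
          have := hloss (Fin.last ℓ)
          linarith
      _ ≤ _ := by
          rw [exp_sum]
          exact Finset.prod_le_prod (fun j _ => (exp_pos _).le) fun j _ => hrate j
  · refine (hpre m i).trans (mul_le_mul ?_ ?_ ?_ (by positivity))
    · rw [Finset.sum_const, nsmul_eq_mul]
      refine mul_le_mul_of_nonneg_right ?_ (by positivity)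
      have := Finset.card_le_univ (Finset.Iic i.castSucc)
      rw [Fintype.card_fin] at this
      exact_mod_cast this
    · calc _ ≤ ∏ j ∈ Finset.Ioi i.castSucc, exp (loss j - a j * Ch.J (ρ j)) :=
            Finset.prod_le_prod (fun j _ => (exp_pos _).le) fun j _ => hβ j
        _ ≤ _ := by
            rw [← exp_sum, exp_le_exp, Finset.sum_sub_distrib]
            have h1 : ∑ j ∈ Finset.Ioi i.castSucc, loss j ≤ ∑ j, loss j :=
              Finset.sum_le_sum_of_subset_of_nonneg (Finset.subset_univ _) fun j _ _ => hloss _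
            have h2 : ∑ j ∈ Finset.Ioi i.castSucc, a j * Ch.J (ρ j)
                = n * (∑ j ∈ Finset.Ioi i, η j * Ch.J (R j / η j)
                  + (1 - ∑ j, η j) * Ch.J 0) := by
              rw [sum_Ioi_castSucc]
              simp only [a, ρ, Fin.snoc_castSucc, Fin.snoc_last, mul_assoc, ← Finset.mul_sum]
              ring
            linarith
    · exact Finset.prod_nonneg fun j _ => (exp_pos _).le
  · refine (hera m).trans (le_of_eq ?_)
    rw [Finset.sum_const, Finset.card_univ, Fintype.card_fin, nsmul_eq_mul]
    push_cast
    ring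

/-- The code that always declares an erasure. -/
theorem exists_feedbackCode_of_one_le {X Y : Type*} [Fintype X] [Nonempty X] [Fintype Y]
    (Ch : Channel X Y) {n ℓ : ℕ} (R : Fin ℓ → ℝ) (E : Fin ℓ → ℝ) {ε : ℝ} (hε : 1 ≤ ε) :
    ∃ (M : Fin ℓ → ℕ) (code : FeedbackCode X Y (∀ j, Fin (M j)) n),
      (∀ i, exp (n * (R i - ε)) ≤ M i) ∧
      (∀ i, exp (n * (-ε + ∑ j ∈ Finset.Iic i, R j)) ≤ ∏ j ∈ Finset.Iic i, (M j : ℝ)) ∧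
      (∀ m i, code.prefixErrorProb Ch m i ≤ ε * exp (E i)) ∧
      ∀ m, code.erasureProb Ch m ≤ ε := by
  have hn : (0 : ℝ) ≤ n := Nat.cast_nonneg n
  have hnε : 0 ≤ n * ε := mul_nonneg hn (by linarith)
  refine ⟨fun j => ⌈exp (n * R j)⌉₊, ⟨fun _ _ _ => Classical.arbitrary X, fun _ => none⟩,
    fun i => ?_, fun i => ?_, fun m i => ?_, fun m => ?_⟩
  · exact (exp_le_exp.2 (by linarith)).trans (Nat.le_ceil _)
  · calc _ ≤ exp (∑ j ∈ Finset.Iic i, n * R j) := by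
          rw [exp_le_exp, ← Finset.mul_sum]
          linarith
      _ ≤ _ := by
          rw [exp_sum]
          exact Finset.prod_le_prod (fun j _ => (exp_pos _).le) fun j _ => Nat.le_ceil _
  · simp only [FeedbackCode.prefixErrorProb, FeedbackCode.condProb, reduceCtorEq, false_and,
      exists_false]
    have h0 : (0 : ℝ) ≤ ε * exp (E i) := mul_nonneg (by linarith) (exp_pos _).le
    simpa using h0
  · simp only [FeedbackCode.erasureProb, FeedbackCode.condProb]
    refine le_trans (le_of_eq ?_) hε
    have h1 := Channel.sum_prod_eq_one (N := n)
      fun _ => Ch.sum_eq_one (Classical.arbitrary X)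
    refine (Finset.sum_congr rfl fun y _ => ?_).trans h1
    simp [FeedbackCode.pathProb]

-- Choice of the parameters.

theorem Channel.log_exp_one_div_minProb {X Y : Type*} [Fintype X] [Nonempty X] [Fintype Y]
    (Ch : Channel X Y) : log (exp 1 / Ch.minProb) = 1 + Ch.maxLLR := by
  rw [log_div (exp_pos 1).ne' Ch.minProb_pos.ne', log_exp, Channel.maxLLR, sub_eq_add_neg]

end BitwiseUEP

theorem lemma4 {X Y : Type*} [Fintype X] [Nonempty X] [Fintype Y]
    (Ch : BitwiseUEP.Channel X Y) (n ℓ : ℕ) (hn : 1 ≤ n)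
    (hℓ : (ℓ : ℝ) ≤ (n : ℝ) / Real.log (1 + (n : ℝ)))
    (R η : Fin ℓ → ℝ)
    (hR : ∀ i, R i ≤ Ch.capacity * η i)
    (hη : ∀ i, 0 ≤ η i)
    (hsum : ∑ i, η i ≤ 1) :
    ∃ (M : Fin ℓ → ℕ) (code : BitwiseUEP.FeedbackCode X Y (∀ j, Fin (M j)) n),
      (∀ i, Real.exp ((n : ℝ) * (R i - Ch.eps n ℓ)) ≤ (M i : ℝ)) ∧
      (∀ i, Real.exp ((n : ℝ) * (-Ch.eps n ℓ + ∑ j ∈ Finset.Iic i, R j))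
        ≤ ∏ j ∈ Finset.Iic i, (M j : ℝ)) ∧
      (∀ m i, code.prefixErrorProb Ch m i ≤
        Ch.eps n ℓ * Real.exp (-(n : ℝ) * (-Ch.eps n ℓ
          + (∑ j ∈ Finset.Ioi i, η j * Ch.J (R j / η j)
            + (1 - ∑ j, η j) * Ch.J 0)))) ∧
      (∀ m, code.erasureProb Ch m ≤ Ch.eps n ℓ) := by
  -- For ε ≥ 1 permanent erasure suffices; otherwise ε < 1 makes r below at most 1/10.
  rcases le_or_gt 1 (Ch.eps n ℓ) with h1 | h1
  · exact BitwiseUEP.exists_feedbackCode_of_one_le Ch R _ h1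
  have hn0 : (1 : ℝ) ≤ n := by exact_mod_cast hn
  have hL := Ch.maxLLR_nonneg
  have : Nonempty Y := Ch.nonempty_output
  have hlog : 1 / 2 ≤ Real.log (1 + (n : ℝ)) := by
    have h2 := Real.log_two_gt_d9
    have h3 := Real.log_le_log (by norm_num) (by linarith : (2 : ℝ) ≤ 1 + n)
    linarith
  set L := Ch.maxLLR with hLdef
  set lg := Real.log (1 + (n : ℝ)) with hlg
  obtain ⟨r, hr⟩ : ∃ r, r = √lg / √n * √(1 + ℓ) := ⟨_, rfl⟩
  have hr0 : 0 < r := by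
    rw [hr]
    have : 0 < √lg := Real.sqrt_pos.2 (by linarith)
    have : 0 < √(n : ℝ) := Real.sqrt_pos.2 (by linarith)
    have : 0 < √(1 + (ℓ : ℝ)) := Real.sqrt_pos.2 (by positivity)
    positivity
  have hr2 : (ℓ + 1) * lg = n * r ^ 2 := by
    rw [hr, mul_pow, div_pow, Real.sq_sqrt (by linarith), Real.sq_sqrt (by linarith),
      Real.sq_sqrt (by positivity)]
    field_simp
    ring
  have hεr : 10 * (1 + L) * r ≤ Ch.eps n ℓ := by
    have hX : (1 : ℝ) ≤ Fintype.card X := by exact_mod_cast Fintype.card_pos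
    have hY : (1 : ℝ) ≤ Fintype.card Y := by exact_mod_cast Fintype.card_pos
    have hXY : (1 : ℝ) ≤ Fintype.card X * Fintype.card Y := one_le_mul_of_one_le_of_one_le hX hY
    have he : Ch.eps n ℓ = (Fintype.card X * Fintype.card Y) * (10 * (1 + L) * r) := by
      rw [BitwiseUEP.Channel.eps, Ch.log_exp_one_div_minProb, hr]
      ring
    rw [he]
    exact le_mul_of_one_le_left (by positivity) hXY
  have hr1 : r ≤ 1 / 10 := by nlinarith
  have hℓr : (ℓ + 1 : ℝ) ≤ 2 * (n * r ^ 2) := by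
    rw [← hr2]
    nlinarith [(Nat.cast_nonneg ℓ : (0 : ℝ) ≤ ℓ)]
  have hnr : n * r ^ 2 ≤ n * r / 10 := by nlinarith [mul_pos (by linarith : (0 : ℝ) < n) hr0]
  have hp0 : (0 : ℝ) < 1 / (1 + n) := by positivity
  have hlp : -Real.log (1 / (1 + (n : ℝ))) = lg := by
    rw [one_div, Real.log_inv, neg_neg]
  have hprob : (ℓ + 1) * (3 * (1 / (1 + (n : ℝ)))) ≤ Ch.eps n ℓ := by
    have h2 : (ℓ + 1) * (3 * (1 / (1 + (n : ℝ)))) ≤ r := by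
      rw [← mul_assoc, mul_one_div, div_le_iff₀ (by positivity)]
      nlinarith
    nlinarith
  -- By `hr2`, s of order r/L balances the costs sL²n and (ℓ + 1)(-log p)/s; the denominator 1 + L
  -- also covers L = 0. Each cost is then at most nr(1 + L), and all five together stay below 10(1 +
  -- L)nr ≤ nε.
  obtain ⟨M, code, hM, hMprod, herr, hera⟩ := BitwiseUEP.exists_feedbackCode_of_params Ch (n := n)
    (s := r / (1 + L)) (p := 1 / (1 + n)) (κ := r) (T := n * Ch.eps n ℓ) hR hη hsum
    (by positivity)
    (by
      rw [← hLdef, mul_div_assoc', div_mul_eq_mul_div, div_le_one (by positivity)]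
      nlinarith)
    hp0 (by rw [div_le_one (by positivity)]; linarith) hr0
    (by
      rw [hlp, ← hLdef]
      have e1 : (ℓ + 1) * (lg / (r / (1 + L))) = n * r * (1 + L) := by
        rw [← mul_div_assoc, hr2]
        field_simp
      have e2 : r / (1 + L) * L ^ 2 * n ≤ n * r * (1 + L) := by
        rw [div_mul_eq_mul_div, div_mul_eq_mul_div, div_le_iff₀ (by positivity)]
        have : 0 ≤ n * r := by positivity
        nlinarith [mul_nonneg this hL]
      have e3 : (ℓ + 1) * (2 * L) ≤ n * r * L := by nlinarith
      have e4 := mul_le_mul_of_nonneg_left hεr (by linarith : (0 : ℝ) ≤ n)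
      have e5 : 0 ≤ n * r * L := by positivity
      rw [e1, hr2]
      nlinarith)
  refine ⟨M, code, fun i => ?_, fun i => ?_, fun m i => ?_, fun m => (hera m).trans hprob⟩
  · rw [mul_sub]
    exact hM i
  · rw [mul_add, mul_neg, neg_add_eq_sub]
    exact hMprod i
  · refine (herr m i).trans (mul_le_mul hprob (le_of_eq ?_) (Real.exp_pos _).le
      (le_trans (by positivity) hprob))
    congr 1
    ring
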